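/- Let $X$ be a real Banach space with topological dual $X^*$, and write $\bar{\mathbf B}$ for the closed unit ball of $X$. For a closed set $S\subset X$ and $x_0\in S$, the Clarke tangent cone $\hat T_S(x_0)$ is the set of all $v\in X$ such that for every $\varepsilon>0$ there exist $\delta>0$ and $\lambda>0$ for which $S\cap\bigl(x+t(v+\varepsilon\bar{\mathbf B})\bigr)\neq\emptyset$ for all $x\in S\cap(x_0+\delta\bar{\mathbf B})$ and all $t\in[0,\lambda]$. The Clarke normal cone is its polar, $N_S(x_0)=\{x^*\in X^* : \langle x^*,v\rangle\le 0 \text{ for all } v\in\hat T_S(x_0)\}$. Let $A,B\subset X$ be closed and let $x_0\in A\cap B$. Suppose the following. (1) $A$ and $B$ are tangentially transversal at $x_0$: there exist $M>0$, $\delta>0$ and $\eta>0$ such that for any two different points $x^A\in(x_0+\delta\bar{\mathbf B})\cap A$ and $x^B\in(x_0+\delta\bar{\mathbf B})\cap B$ there is a sequence of positive reals $t_m\searrow 0$ such that for every $m\in\mathbb N$ there exist $w^A_m,w^B_m\in X$ with $\|w^A_m\|\le M$, $\|w^B_m\|\le M$, $x^A+t_mw^A_m\in A$, $x^B+t_mw^B_m\in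 B$ and $$\|x^A-x^B+t_m(w^A_m-w^B_m)\|\le\|x^A-x^B\|-t_m\eta .$$ (2) The Clarke tangent cones $\hat T_A(x_0)$ and $\hat T_B(x_0)$ are transversal: there exists $\rho>0$ such that $$\rho\bar{\mathbf B}\subset\overline{(\hat T_A(x_0)\cap\bar{\mathbf B})-(\hat T_B(x_0)\cap\bar{\mathbf B})},$$ the closure being taken in the norm topology. Then $$N_{A\cap B}(x_0)\subset N_A(x_0)+N_B(x_0),$$ and $N_A(x_0)+N_B(x_0)$ is a weak$^*$-closed subset of $X^*$. -/

import Mathlib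

open Set Filter Topology Metric
open scoped Pointwise

/-- The Clarke tangent cone to `S` at `x₀`: the vectors `v` such that for each `ε > 0` there are
`δ, lam > 0` for which `S ∩ (x + t (v + ε 𝐁̄))` is nonempty for all `x ∈ S ∩ (x₀ + δ 𝐁̄)` and all
`t ∈ [0, lam]`. -/
def clarkeTangentCone {X : Type*} [NormedAddCommGroup X] [NormedSpace ℝ X]
    (S : Set X) (x₀ : X) : Set X :=
  {v | ∀ ε > (0 : ℝ), ∃ δ > (0 : ℝ), ∃ lam > (0 : ℝ), ∀ x ∈ S ∩ closedBall x₀ δ,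
    ∀ t ∈ Icc (0 : ℝ) lam, ∃ w ∈ closedBall v ε, x + t • w ∈ S}

/-- The Clarke normal cone to `S` at `x₀`: the (negative) polar, in the topological dual, of the
Clarke tangent cone. -/
def clarkeNormalCone {X : Type*} [NormedAddCommGroup X] [NormedSpace ℝ X]
    (S : Set X) (x₀ : X) : Set (StrongDual ℝ X) :=
  {f | ∀ v ∈ clarkeTangentCone S x₀, f v ≤ 0}

/-- Tangential transversality of `A` and `B` at `x₀`. The points `a` and `b` are taken distinct:
for `a = b` the last inequality would bound a norm by a negative number. -/
def TangentiallyTransversal {X : Type*} [NormedAddCommGroup X] [NormedSpace ℝ X]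
    (A B : Set X) (x₀ : X) : Prop :=
  ∃ M > (0 : ℝ), ∃ δ > (0 : ℝ), ∃ η > (0 : ℝ),
    ∀ a ∈ closedBall x₀ δ ∩ A, ∀ b ∈ closedBall x₀ δ ∩ B, a ≠ b →
      ∃ t : ℕ → ℝ, (∀ m, 0 < t m) ∧ Antitone t ∧ Tendsto t atTop (𝓝 0) ∧
        ∀ m, ∃ wA wB : X, ‖wA‖ ≤ M ∧ a + t m • wA ∈ A ∧ ‖wB‖ ≤ M ∧ b + t m • wB ∈ B ∧
          ‖a - b + t m • (wA - wB)‖ ≤ ‖a - b‖ - t m * η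

/-- Transversality of two (closed convex) cones:
`ρ 𝐁̄ ⊆ closure ((C₁ ∩ 𝐁̄) - (C₂ ∩ 𝐁̄))` for some `ρ > 0`. -/
def ConesTransversal {X : Type*} [NormedAddCommGroup X] [NormedSpace ℝ X]
    (C₁ C₂ : Set X) : Prop :=
  ∃ ρ > (0 : ℝ), closedBall (0 : X) ρ ⊆
    closure ((C₁ ∩ closedBall (0 : X) 1) - (C₂ ∩ closedBall (0 : X) 1))

/-!
Tangential transversality is a descent condition: from distinct `a ∈ A` and `b ∈ B` near `x₀` the
pair can be moved so that `‖a - b‖` drops at a rate proportional to the length of the move.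
Ekeland's variational principle (`exists_forall_dist_le_sub_imp_eq`) on the complete space of such
pairs turns this into a metric estimate, `TangentiallyTransversal.exists_mem_inter_norm_sub_le`:
`A ∩ B` has a point within `K * ‖a - b‖` of `a`. A vector `v` in both Clarke tangent cones yields
points `x + t • wA ∈ A` and `x + t • wB ∈ B` with `‖wA - wB‖` small, and the estimate corrects them
to one point of `A ∩ B`, so `T_A(x₀) ∩ T_B(x₀) ⊆ T_{A ∩ B}(x₀)` (`inter_clarkeTangentCone_subset`).
Passing to polars, a functional in `N_{A ∩ B}(x₀)` is nonpositive on `T_A(x₀) ∩ T_B(x₀)`.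

The Clarke tangent cones are closed convex cones (`clarkeProperCone`), so what is left is the polar
calculus for two transversal closed convex cones `C₁`, `C₂`: `(C₁ ∩ C₂)° = C₁° + C₂°`. By successive
approximation the closure in the transversality condition may be dropped: each `x` is `c₁ - c₂` with
`‖c₂‖ ≤ K * ‖x‖` (`exists_sub_eq_of_conesTransversal`). If `f ≤ 0` on `C₁ ∩ C₂`, then
`x ↦ inf {-f c₂ | x = c₁ - c₂}` is finite, sublinear and bounded by `K * ‖f‖ * ‖x‖`; a linear
functional below it, given by the Hahn-Banach theorem, is a continuous `g` with `g ∈ C₁°` and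
`f - g ∈ C₂°`. The sum of the normal cones is thus a polar, that is, an intersection of weak*-closed
half-spaces.
-/

/-! ### Ekeland's variational principle -/

/-- Ekeland's variational principle for a nonnegative continuous function on a complete metric
space, in its order form: below each point there is a minimal one for the order
`dist y z ≤ φ y - φ z`. -/
theorem exists_forall_dist_le_sub_imp_eq {Y : Type*} [MetricSpace Y] [CompleteSpace Y]
    {φ : Y → ℝ} (hφ : Continuous φ) (hpos : ∀ y, 0 ≤ φ y) (y₀ : Y) :
    ∃ y, dist y₀ y ≤ φ y₀ - φ y ∧ ∀ z, dist y z ≤ φ y - φ z → z = y := by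
  let S : Y → Set Y := fun y => {z | dist y z ≤ φ y - φ z}
  have hself : ∀ y, y ∈ S y := fun y => by simp [S]
  have htrans : ∀ {x y z}, y ∈ S x → z ∈ S y → z ∈ S x := fun {x y z} h₁ h₂ => by
    have := dist_triangle x y z
    simp only [S, mem_ofPred_eq] at *
    linarith
  have hbdd : ∀ y, BddBelow (φ '' S y) := fun y => ⟨0, by rintro _ ⟨z, -, rfl⟩; exact hpos z⟩
  -- Each step nearly minimizes `φ` over the points below the current one.
  have hstep : ∀ (n : ℕ) (y : Y), ∃ z ∈ S y, ∀ w ∈ S y, φ z ≤ φ w + (1 / 2) ^ n := by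
    intro n y
    obtain ⟨_, ⟨z, hz, rfl⟩, hlt⟩ := exists_lt_of_csInf_lt (⟨_, y, hself y, rfl⟩ : (φ '' S y).Nonempty)
      (lt_add_of_pos_right (sInf (φ '' S y)) (by positivity : (0 : ℝ) < (1 / 2) ^ n))
    exact ⟨z, hz, fun w hw => by linarith [csInf_le (hbdd y) (mem_image_of_mem φ hw)]⟩
  choose g hgS hg using hstep
  let u : ℕ → Y := fun n => Nat.rec y₀ (fun n y => g n y) n
  have hmem : ∀ n m, n ≤ m → u m ∈ S (u n) := by
    intro n m h
    induction m, h using Nat.le_induction with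
    | base => exact hself _
    | succ m _ ih => exact htrans ih (hgS m (u m))
  have hsmall : ∀ n, ∀ z ∈ S (u (n + 1)), dist (u (n + 1)) z ≤ (1 / 2) ^ n := by
    intro n z hz
    have h₁ : φ (u (n + 1)) ≤ φ z + (1 / 2) ^ n := hg n (u n) z (htrans (hgS n (u n)) hz)
    have h₂ : dist (u (n + 1)) z ≤ φ (u (n + 1)) - φ z := hz
    linarith
  have hlim : Tendsto (fun n : ℕ => (1 / 2 : ℝ) ^ n) atTop (𝓝 0) :=
    tendsto_pow_atTop_nhds_zero_of_lt_one (by norm_num) (by norm_num)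
  have hcauchy : CauchySeq fun n => u (n + 1) :=
    cauchySeq_of_le_tendsto_0' (fun n => (1 / 2 : ℝ) ^ n)
      (fun n m hnm => hsmall n _ (hmem _ _ (Nat.add_le_add_right hnm 1))) hlim
  obtain ⟨y, hy⟩ := cauchySeq_tendsto_of_complete hcauchy
  have hclosed : ∀ x, IsClosed (S x) := fun x =>
    isClosed_le (continuous_const.dist continuous_id) (continuous_const.sub hφ)
  have hyS : ∀ n, y ∈ S (u n) := fun n =>
    (hclosed _).mem_of_tendsto hy
      ((eventually_ge_atTop n).mono fun m hm => hmem _ _ (Nat.le_succ_of_le hm))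
  refine ⟨y, hyS 0, fun z hz => tendsto_nhds_unique ?_ hy⟩
  rw [tendsto_iff_dist_tendsto_zero]
  exact squeeze_zero (fun _ => dist_nonneg) (fun n => hsmall n z (htrans (hyS (n + 1)) hz)) hlim

section

variable {X : Type*} [NormedAddCommGroup X] [NormedSpace ℝ X]

/-! ### The metric estimate from tangential transversality -/

/-- Tangential transversality of closed sets forces a local Lipschitz intersection estimate. -/
theorem TangentiallyTransversal.exists_mem_inter_norm_sub_le [CompleteSpace X] {A B : Set X}
    (hA : IsClosed A) (hB : IsClosed B) {x₀ : X} (h : TangentiallyTransversal A B x₀) :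
    ∃ K > (0 : ℝ), ∃ r > (0 : ℝ), ∀ a ∈ closedBall x₀ r ∩ A, ∀ b ∈ closedBall x₀ r ∩ B,
      ∃ x ∈ A ∩ B, ‖x - a‖ ≤ K * ‖a - b‖ := by
  obtain ⟨M, hM, δ, hδ, η, hη, H⟩ := h
  let K := M / η
  have hK : 0 < K := div_pos hM hη
  -- Pairs in the `r`-ball have gap at most `2r`, so they travel at most `2Kr`; this `r` keeps
  -- them in the ball of radius `δ / 2`.
  let r := δ / (2 * (1 + 2 * K))
  have hr : 0 < r := by positivity
  have hrδ : r + 2 * K * r = δ / 2 := by simp only [r]; field_simp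
  refine ⟨K, hK, r, hr, fun a ha b hb => ?_⟩
  let F : Set (X × X) := (closedBall x₀ δ ∩ A) ×ˢ (closedBall x₀ δ ∩ B)
  have hF : IsClosed F := (isClosed_closedBall.inter hA).prod (isClosed_closedBall.inter hB)
  have : CompleteSpace F := hF.completeSpace_coe
  have hrle : r ≤ δ := by nlinarith [mul_pos hK hr]
  let φ : F → ℝ := fun p => K * ‖p.1.1 - p.1.2‖
  have hφ : Continuous φ := by fun_prop
  obtain ⟨⟨⟨a', b'⟩, ⟨ha', haA⟩, ⟨hb', hbB⟩⟩, hdist, hmin⟩ :=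
    exists_forall_dist_le_sub_imp_eq hφ (fun p => by positivity)
      ⟨(a, b), ⟨closedBall_subset_closedBall hrle ha.1, ha.2⟩,
        ⟨closedBall_subset_closedBall hrle hb.1, hb.2⟩⟩
  simp only [φ, Subtype.dist_eq, Prod.dist_eq] at hdist hmin
  have hgap : ‖a - b‖ ≤ 2 * r := by
    rw [← dist_eq_norm]
    linarith [dist_triangle_right a b x₀, mem_closedBall.1 ha.1, mem_closedBall.1 hb.1]
  have hnn : 0 ≤ K * ‖a' - b'‖ := by positivity
  have hgapK : K * ‖a - b‖ ≤ 2 * K * r := by nlinarith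
  obtain ⟨hda, hdb⟩ := max_le_iff.1 hdist
  have ha2 : dist a' x₀ ≤ δ / 2 := by
    linarith [dist_triangle_left a' x₀ a, mem_closedBall.1 ha.1]
  have hb2 : dist b' x₀ ≤ δ / 2 := by
    linarith [dist_triangle_left b' x₀ b, mem_closedBall.1 hb.1]
  by_cases hab : a' = b'
  · subst hab
    exact ⟨a', ⟨haA, hbB⟩, by rw [← dist_eq_norm, dist_comm]; linarith⟩
  exfalso
  obtain ⟨t, htpos, -, htlim, ht⟩ := H a' ⟨ha', haA⟩ b' ⟨hb', hbB⟩ hab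
  obtain ⟨m, hm⟩ := (htlim.eventually_lt_const (show 0 < δ / (2 * M) by positivity)).exists
  obtain ⟨wA, wB, hwA, hA', hwB, hB', hdec⟩ := ht m
  have htm := htpos m
  have htM : t m * M ≤ δ / 2 := by
    rw [lt_div_iff₀ (by positivity)] at hm
    linarith
  have hmove : ∀ {w : X}, ‖w‖ ≤ M → ∀ c : X, dist c (c + t m • w) ≤ t m * M := fun hw c => by
    rw [dist_self_add_right, norm_smul, Real.norm_of_nonneg htm.le]
    gcongr
  have hgain : t m * M ≤ K * ‖a' - b'‖ - K * ‖a' + t m • wA - (b' + t m • wB)‖ := by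
    have he : a' + t m • wA - (b' + t m • wB) = a' - b' + t m • (wA - wB) := by
      rw [smul_sub]; abel
    have hKη : K * η = M := div_mul_cancel₀ _ hη.ne'
    rw [he]
    nlinarith [mul_le_mul_of_nonneg_left hdec hK.le]
  have hpos : 0 < t m * M := by positivity
  have heq := hmin ⟨(a' + t m • wA, b' + t m • wB),
    ⟨mem_closedBall.2 (by linarith [dist_triangle_left (a' + t m • wA) x₀ a', hmove hwA a']), hA'⟩,
    ⟨mem_closedBall.2 (by linarith [dist_triangle_left (b' + t m • wB) x₀ b', hmove hwB b']), hB'⟩⟩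
    ((max_le (hmove hwA a') (hmove hwB b')).trans hgain)
  have hA0 : a' + t m • wA = a' := congrArg (fun q => q.1.1) heq
  have hB0 : b' + t m • wB = b' := congrArg (fun q => q.1.2) heq
  rw [hA0, hB0] at hgain
  linarith

/-! ### The Clarke tangent cone -/

theorem add_mem_clarkeTangentCone {S : Set X} {x₀ v₁ v₂ : X} (h₁ : v₁ ∈ clarkeTangentCone S x₀)
    (h₂ : v₂ ∈ clarkeTangentCone S x₀) : v₁ + v₂ ∈ clarkeTangentCone S x₀ := by
  intro ε hε
  obtain ⟨δ₁, hδ₁, l₁, hl₁, H₁⟩ := h₁ (ε / 2) (by positivity)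
  obtain ⟨δ₂, hδ₂, l₂, hl₂, H₂⟩ := h₂ (ε / 2) (by positivity)
  -- The bound on `t` keeps the intermediate point `x + t • w₁` in the `δ₂`-ball.
  let l := δ₂ / 2 / (‖v₁‖ + ε / 2)
  refine ⟨min δ₁ (δ₂ / 2), by positivity, min (min l₁ l₂) l, by positivity, fun x hx t ht => ?_⟩
  obtain ⟨htl, htl'⟩ := le_min_iff.1 ht.2
  obtain ⟨ht₁, ht₂⟩ := le_min_iff.1 htl
  obtain ⟨hx₁, hx₂⟩ := le_min_iff.1 (mem_closedBall.1 hx.2)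
  obtain ⟨w₁, hw₁, hS₁⟩ := H₁ x ⟨hx.1, hx₁⟩ t ⟨ht.1, ht₁⟩
  have hw₁n : ‖w₁‖ ≤ ‖v₁‖ + ε / 2 := norm_le_of_mem_closedBall hw₁
  have hmove : dist x (x + t • w₁) ≤ δ₂ / 2 := by
    rw [dist_self_add_right, norm_smul, Real.norm_of_nonneg ht.1]
    calc t * ‖w₁‖ ≤ t * (‖v₁‖ + ε / 2) := mul_le_mul_of_nonneg_left hw₁n ht.1
      _ ≤ δ₂ / 2 := (le_div_iff₀ (by positivity)).1 htl'
  obtain ⟨w₂, hw₂, hS₂⟩ := H₂ (x + t • w₁)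
    ⟨hS₁, mem_closedBall.2 (by linarith [dist_triangle_left (x + t • w₁) x₀ x])⟩ t ⟨ht.1, ht₂⟩
  refine ⟨w₁ + w₂, mem_closedBall.2 ?_, by rwa [smul_add, ← add_assoc]⟩
  linarith [dist_add_add_le w₁ w₂ v₁ v₂, mem_closedBall.1 hw₁, mem_closedBall.1 hw₂]

theorem zero_mem_clarkeTangentCone (S : Set X) (x₀ : X) : (0 : X) ∈ clarkeTangentCone S x₀ :=
  fun _ hε => ⟨1, one_pos, 1, one_pos, fun _ hx _ _ =>
    ⟨0, mem_closedBall_self hε.le, by simpa using hx.1⟩⟩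

theorem smul_mem_clarkeTangentCone {S : Set X} {x₀ v : X} (h : v ∈ clarkeTangentCone S x₀)
    {c : ℝ} (hc : 0 ≤ c) : c • v ∈ clarkeTangentCone S x₀ := by
  rcases hc.eq_or_lt with rfl | hc
  · simpa using zero_mem_clarkeTangentCone S x₀
  intro ε hε
  obtain ⟨δ, hδ, l, hl, H⟩ := h (ε / c) (by positivity)
  refine ⟨δ, hδ, l / c, by positivity, fun x hx t ht => ?_⟩
  obtain ⟨w, hw, hS⟩ := H x hx (t * c) ⟨mul_nonneg ht.1 hc.le, (le_div_iff₀ hc).1 ht.2⟩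
  refine ⟨c • w, mem_closedBall.2 ?_, by rwa [smul_smul]⟩
  rw [dist_smul₀, Real.norm_of_nonneg hc.le, mul_comm]
  exact (le_div_iff₀ hc).1 hw

theorem isClosed_clarkeTangentCone (S : Set X) (x₀ : X) : IsClosed (clarkeTangentCone S x₀) := by
  refine isClosed_of_closure_subset fun v hv ε hε => ?_
  obtain ⟨v', hv', hd⟩ := Metric.mem_closure_iff.1 hv (ε / 2) (by positivity)
  obtain ⟨δ, hδ, l, hl, H⟩ := hv' (ε / 2) (by positivity)
  refine ⟨δ, hδ, l, hl, fun x hx t ht => ?_⟩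
  obtain ⟨w, hw, hS⟩ := H x hx t ht
  refine ⟨w, mem_closedBall.2 ?_, hS⟩
  linarith [dist_triangle_right w v v', mem_closedBall.1 hw]

/-- The Clarke tangent cone as a closed convex cone. -/
def clarkeProperCone (S : Set X) (x₀ : X) : ProperCone ℝ X where
  carrier := clarkeTangentCone S x₀
  add_mem' := add_mem_clarkeTangentCone
  zero_mem' := zero_mem_clarkeTangentCone S x₀
  smul_mem' c _ h := smul_mem_clarkeTangentCone h c.2
  isClosed' := isClosed_clarkeTangentCone S x₀

theorem inter_clarkeTangentCone_subset [CompleteSpace X] {A B : Set X} (hA : IsClosed A)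
    (hB : IsClosed B) {x₀ : X} (h : TangentiallyTransversal A B x₀) :
    clarkeTangentCone A x₀ ∩ clarkeTangentCone B x₀ ⊆ clarkeTangentCone (A ∩ B) x₀ := by
  obtain ⟨K, hK, r, hr, H⟩ := h.exists_mem_inter_norm_sub_le hA hB
  rintro v ⟨hvA, hvB⟩ ε hε
  -- The two approximations are `2ε'` apart, so correcting costs `2Kε'`, and `(1 + 2K) ε' = ε`.
  let ε' := ε / (1 + 2 * K)
  have hε' : 0 < ε' := by positivity
  have hεK : ε' + K * (2 * ε') = ε := by simp only [ε']; field_simp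
  obtain ⟨δ₁, hδ₁, l₁, hl₁, H₁⟩ := hvA ε' hε'
  obtain ⟨δ₂, hδ₂, l₂, hl₂, H₂⟩ := hvB ε' hε'
  let l := r / 2 / (‖v‖ + ε')
  refine ⟨min (min δ₁ δ₂) (r / 2), by positivity, min (min l₁ l₂) l, by positivity,
    fun x hx t ht => ?_⟩
  obtain ⟨htl, htl'⟩ := le_min_iff.1 ht.2
  obtain ⟨ht₁, ht₂⟩ := le_min_iff.1 htl
  obtain ⟨hx₁₂, hxr⟩ := le_min_iff.1 (mem_closedBall.1 hx.2)
  obtain ⟨hx₁, hx₂⟩ := le_min_iff.1 hx₁₂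
  rcases ht.1.eq_or_lt with rfl | htpos
  · exact ⟨v, mem_closedBall_self hε.le, by simpa using hx.1⟩
  obtain ⟨wA, hwA, hSA⟩ := H₁ x ⟨hx.1.1, hx₁⟩ t ⟨ht.1, ht₁⟩
  obtain ⟨wB, hwB, hSB⟩ := H₂ x ⟨hx.1.2, hx₂⟩ t ⟨ht.1, ht₂⟩
  have hmove : ∀ w ∈ closedBall v ε', x + t • w ∈ closedBall x₀ r := fun w hw => by
    have : dist x (x + t • w) ≤ r / 2 := by
      rw [dist_self_add_right, norm_smul, Real.norm_of_nonneg ht.1]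
      calc t * ‖w‖ ≤ t * (‖v‖ + ε') :=
            mul_le_mul_of_nonneg_left (norm_le_of_mem_closedBall hw) ht.1
        _ ≤ r / 2 := (le_div_iff₀ (by positivity)).1 htl'
    exact mem_closedBall.2 (by linarith [dist_triangle_left (x + t • w) x₀ x])
  obtain ⟨y, hy, hya⟩ := H _ ⟨hmove wA hwA, hSA⟩ _ ⟨hmove wB hwB, hSB⟩
  have hgap : ‖x + t • wA - (x + t • wB)‖ ≤ t * (2 * ε') := by
    rw [add_sub_add_left_eq_sub, ← smul_sub, norm_smul, Real.norm_of_nonneg ht.1, ← dist_eq_norm]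
    gcongr
    linarith [dist_triangle_right wA wB v, mem_closedBall.1 hwA, mem_closedBall.1 hwB]
  have hw : dist (t⁻¹ • (y - x)) wA ≤ K * (2 * ε') := by
    have he : t⁻¹ • (y - x) - wA = t⁻¹ • (y - (x + t • wA)) := by
      rw [← sub_sub, smul_sub _ (y - x), inv_smul_smul₀ htpos.ne']
    rw [dist_eq_norm, he, norm_smul, norm_inv, Real.norm_of_nonneg ht.1, inv_mul_le_iff₀ htpos]
    nlinarith [mul_le_mul_of_nonneg_left hgap hK.le]
  refine ⟨t⁻¹ • (y - x), mem_closedBall.2 ?_, ?_⟩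
  · linarith [dist_triangle (t⁻¹ • (y - x)) wA v, mem_closedBall.1 hwA]
  · rwa [smul_inv_smul₀ htpos.ne', add_sub_cancel]

/-! ### Polars of transversal closed convex cones -/

/-- Successive approximation removes the closure from the transversality condition. -/
theorem exists_sub_eq_of_conesTransversal [CompleteSpace X] {C₁ C₂ : ProperCone ℝ X}
    (h : ConesTransversal (C₁ : Set X) (C₂ : Set X)) :
    ∃ K > (0 : ℝ), ∀ x : X, ∃ c₁ ∈ C₁, ∃ c₂ ∈ C₂, c₁ - c₂ = x ∧ ‖c₂‖ ≤ K * ‖x‖ := by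
  obtain ⟨ρ, hρ, hsub⟩ := h
  have hstep : ∀ x : X, ∃ c₁ ∈ C₁, ∃ c₂ ∈ C₂, ‖c₁‖ ≤ ‖x‖ / ρ ∧ ‖c₂‖ ≤ ‖x‖ / ρ ∧
      ‖x - (c₁ - c₂)‖ ≤ 1 / 2 * ‖x‖ := by
    intro x
    rcases eq_or_ne x 0 with rfl | hx
    · exact ⟨0, zero_mem _, 0, zero_mem _, by simp⟩
    have hxn : 0 < ‖x‖ := norm_pos_iff.2 hx
    let s := ‖x‖ / ρ
    have hs : 0 < s := by positivity
    have hball : s⁻¹ • x ∈ closedBall (0 : X) ρ := by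
      rw [mem_closedBall_zero_iff, norm_smul, norm_inv, Real.norm_of_nonneg hs.le]
      simp only [s]
      field_simp
      exact le_rfl
    obtain ⟨_, ⟨c₁, ⟨hc₁, hn₁⟩, c₂, ⟨hc₂, hn₂⟩, rfl⟩, hd⟩ :=
      Metric.mem_closure_iff.1 (hsub hball) (ρ / 2) (by positivity)
    have hn : ∀ {c : X}, c ∈ closedBall (0 : X) 1 → ‖s • c‖ ≤ s := fun hc => by
      rw [norm_smul, Real.norm_of_nonneg hs.le]
      exact mul_le_of_le_one_right hs.le (mem_closedBall_zero_iff.1 hc)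
    refine ⟨s • c₁, C₁.smul_mem hc₁ hs.le, s • c₂, C₂.smul_mem hc₂ hs.le, hn hn₁, hn hn₂, ?_⟩
    have he : x - (s • c₁ - s • c₂) = s • (s⁻¹ • x - (c₁ - c₂)) := by
      rw [smul_sub s (s⁻¹ • x), smul_inv_smul₀ hs.ne', smul_sub]
    rw [he, norm_smul, Real.norm_of_nonneg hs.le, ← dist_eq_norm]
    calc s * dist (s⁻¹ • x) (c₁ - c₂) ≤ s * (ρ / 2) := by gcongr
      _ = 1 / 2 * ‖x‖ := by simp only [s]; field_simp
  choose g₁ hg₁ g₂ hg₂ hn₁ hn₂ hres using hstep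
  refine ⟨2 / ρ, by positivity, fun x => ?_⟩
  let e : ℕ → X := fun n => (fun y => y - (g₁ y - g₂ y))^[n] x
  have hsucc : ∀ n, e (n + 1) = e n - (g₁ (e n) - g₂ (e n)) := fun n =>
    Function.iterate_succ_apply' _ _ _
  have he : ∀ n, ‖e n‖ ≤ (1 / 2) ^ n * ‖x‖ := by
    intro n
    induction n with
    | zero => simp [e]
    | succ n ih =>
      rw [hsucc, pow_succ', mul_assoc]
      exact (hres _).trans (by gcongr)
  have hgeom : HasSum (fun n : ℕ => (1 / 2 : ℝ) ^ n * (‖x‖ / ρ)) (2 / ρ * ‖x‖) := by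
    simpa only [mul_div_assoc, div_mul_eq_mul_div] using hasSum_geometric_two.mul_right (‖x‖ / ρ)
  have hbound : ∀ {c : X} (n : ℕ), ‖c‖ ≤ ‖e n‖ / ρ → ‖c‖ ≤ (1 / 2) ^ n * (‖x‖ / ρ) := by
    intro c n hc
    refine hc.trans ?_
    rw [← mul_div_assoc]
    gcongr
    exact he n
  have hs₁ : Summable fun n => g₁ (e n) :=
    .of_norm_bounded hgeom.summable fun n => hbound n (hn₁ _)
  have hs₂ : Summable fun n => g₂ (e n) :=
    .of_norm_bounded hgeom.summable fun n => hbound n (hn₂ _)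
  have htsum : ∀ (C : ProperCone ℝ X) {u : ℕ → X}, Summable u → (∀ n, u n ∈ C) →
      ∑' n, u n ∈ C := fun C u hu hC =>
    C.isClosed.mem_of_tendsto hu.hasSum (Eventually.of_forall fun s => sum_mem fun n _ => hC n)
  refine ⟨_, htsum C₁ hs₁ fun n => hg₁ _, _, htsum C₂ hs₂ fun n => hg₂ _, ?_,
    tsum_of_norm_bounded hgeom fun n => hbound n (hn₂ _)⟩
  rw [← hs₁.tsum_sub hs₂]
  have hpart : ∀ n, ∑ i ∈ Finset.range n, (g₁ (e i) - g₂ (e i)) = x - e n := by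
    intro n
    induction n with
    | zero => simp [e]
    | succ n ih => rw [Finset.sum_range_succ, ih, hsucc]; abel
  have he0 : Tendsto e atTop (𝓝 0) := by
    refine squeeze_zero_norm he ?_
    simpa using (tendsto_pow_atTop_nhds_zero_of_lt_one (by norm_num : (0 : ℝ) ≤ 1 / 2)
      (by norm_num)).mul_const ‖x‖
  refine tendsto_nhds_unique (hs₁.sub hs₂).hasSum.tendsto_sum_nat ?_
  simp only [hpart]
  simpa using tendsto_const_nhds.sub he0

/-- The nontrivial inclusion of `(C₁ ∩ C₂)° = C₁° + C₂°` for transversal closed convex cones. -/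
theorem exists_polar_add_of_conesTransversal [CompleteSpace X] {C₁ C₂ : ProperCone ℝ X}
    (h : ConesTransversal (C₁ : Set X) (C₂ : Set X)) {f : StrongDual ℝ X}
    (hf : ∀ c ∈ C₁, c ∈ C₂ → f c ≤ 0) :
    ∃ g : StrongDual ℝ X, (∀ c ∈ C₁, g c ≤ 0) ∧ ∀ c ∈ C₂, (f - g) c ≤ 0 := by
  obtain ⟨K, hK, hdec⟩ := exists_sub_eq_of_conesTransversal h
  let P : X → Set ℝ := fun x => {s | ∃ c₁ ∈ C₁, ∃ c₂ ∈ C₂, c₁ - c₂ = x ∧ -f c₂ = s}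
  have hne : ∀ x, (P x).Nonempty := fun x => by
    obtain ⟨c₁, h₁, c₂, h₂, hx, -⟩ := hdec x
    exact ⟨_, c₁, h₁, c₂, h₂, hx, rfl⟩
  have hbdd : ∀ x, BddBelow (P x) := fun x => by
    -- Adding a decomposition of `-x` to one of `x` produces a vector of `C₁ ∩ C₂`.
    obtain ⟨d₁, hd₁, d₂, hd₂, hd, -⟩ := hdec (-x)
    refine ⟨f d₂, ?_⟩
    rintro _ ⟨c₁, h₁, c₂, h₂, hx, rfl⟩
    have he : c₁ + d₁ = c₂ + d₂ := by
      rw [← sub_eq_zero, add_sub_add_comm, hx, hd, add_neg_cancel]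
    have := hf (c₂ + d₂) (he ▸ add_mem h₁ hd₁) (add_mem h₂ hd₂)
    rw [map_add] at this
    linarith
  let p : X → ℝ := fun x => sInf (P x)
  have hp_le : ∀ {c₁ c₂ x}, c₁ ∈ C₁ → c₂ ∈ C₂ → c₁ - c₂ = x → p x ≤ -f c₂ :=
    fun h₁ h₂ hx => csInf_le (hbdd _) ⟨_, h₁, _, h₂, hx, rfl⟩
  have hp_add : ∀ x y, p (x + y) ≤ p x + p y := fun x y => by
    simp only [p]
    rw [← csInf_add (hne x) (hbdd x) (hne y) (hbdd y)]
    refine csInf_le_csInf (hbdd _) ((hne x).add (hne y)) ?_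
    rintro _ ⟨_, ⟨c₁, h₁, c₂, h₂, rfl, rfl⟩, _, ⟨d₁, hd₁, d₂, hd₂, rfl, rfl⟩, rfl⟩
    exact ⟨c₁ + d₁, add_mem h₁ hd₁, c₂ + d₂, add_mem h₂ hd₂, add_sub_add_comm .., by
      simp only [map_add]; ring⟩
  have hp_smul_le : ∀ c : ℝ, 0 < c → ∀ x, p (c • x) ≤ c * p x := fun c hc x => by
    rw [← div_le_iff₀' hc]
    refine le_csInf (hne x) ?_
    rintro _ ⟨c₁, h₁, c₂, h₂, rfl, rfl⟩
    rw [div_le_iff₀' hc]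
    have := hp_le (C₁.smul_mem h₁ hc.le) (C₂.smul_mem h₂ hc.le) (smul_sub c c₁ c₂).symm
    simpa using this
  have hp_smul : ∀ c : ℝ, 0 < c → ∀ x, p (c • x) = c * p x := fun c hc x => by
    refine (hp_smul_le c hc x).antisymm ?_
    have := hp_smul_le c⁻¹ (inv_pos.2 hc) (c • x)
    rwa [inv_smul_smul₀ hc.ne', ← div_eq_inv_mul, le_div_iff₀' hc] at this
  have hp_zero : 0 ≤ p 0 := by
    have := hp_add 0 0
    rw [add_zero] at this
    linarith
  obtain ⟨g, -, hg⟩ := exists_extension_of_le_sublinear (⊥ : X →ₗ.[ℝ] ℝ) p hp_smul hp_add (by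
    rintro ⟨x, hx⟩
    obtain rfl : x = 0 := (Submodule.mem_bot ℝ).1 hx
    exact (LinearMap.map_zero _).le.trans hp_zero)
  have hg_le : ∀ x, g x ≤ ‖f‖ * K * ‖x‖ := fun x => by
    obtain ⟨c₁, h₁, c₂, h₂, hx, hn⟩ := hdec x
    calc g x ≤ -f c₂ := (hg x).trans (hp_le h₁ h₂ hx)
      _ ≤ ‖f c₂‖ := neg_le_abs _
      _ ≤ ‖f‖ * ‖c₂‖ := f.le_opNorm _
      _ ≤ ‖f‖ * K * ‖x‖ := by rw [mul_assoc]; gcongr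
  let G : StrongDual ℝ X := g.mkContinuous (‖f‖ * K) fun x => abs_le.2
    ⟨by have := hg_le (-x); rw [map_neg, norm_neg] at this; linarith, hg_le x⟩
  refine ⟨G, fun c hc => ?_, fun c hc => ?_⟩
  · have : g c ≤ -f 0 := (hg c).trans (hp_le hc (zero_mem C₂) (sub_zero c))
    rwa [map_zero, neg_zero] at this
  · have : g (-c) ≤ -f c := (hg (-c)).trans (hp_le (zero_mem C₁) hc (zero_sub c))
    rw [map_neg] at this
    change f c - g c ≤ 0
    linarith

/-- Transversality of the Clarke tangent cones makes the sum of the Clarke normal cones the polar of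
the intersection of the tangent cones. -/
theorem clarkeNormalCone_add_eq [CompleteSpace X] {A B : Set X} {x₀ : X}
    (h : ConesTransversal (clarkeTangentCone A x₀) (clarkeTangentCone B x₀)) :
    clarkeNormalCone A x₀ + clarkeNormalCone B x₀ =
      {f : StrongDual ℝ X | ∀ v ∈ clarkeTangentCone A x₀ ∩ clarkeTangentCone B x₀, f v ≤ 0} := by
  ext f
  constructor
  · rintro ⟨g₁, h₁, g₂, h₂, rfl⟩ v hv
    exact add_nonpos (h₁ v hv.1) (h₂ v hv.2)
  · intro hf
    obtain ⟨g, hgA, hgB⟩ := exists_polar_add_of_conesTransversal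
      (C₁ := clarkeProperCone A x₀) (C₂ := clarkeProperCone B x₀) h
      fun c h₁ h₂ => hf c ⟨h₁, h₂⟩
    exact ⟨g, hgA, f - g, hgB, add_sub_cancel g f⟩

theorem isClosed_toWeakDual_image_polar (C : Set X) :
    IsClosed (StrongDual.toWeakDual '' {f : StrongDual ℝ X | ∀ v ∈ C, f v ≤ 0} :
      Set (WeakDual ℝ X)) := by
  rw [LinearEquiv.image_eq_preimage_symm]
  simp only [ofPred_forall]
  exact isClosed_biInter fun v _ => isClosed_le (WeakDual.eval_continuous v) continuous_const

end

theorem mainTheorem1 {X : Type*} [NormedAddCommGroup X] [NormedSpace ℝ X] [CompleteSpace X]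
    (A B : Set X) (hA : IsClosed A) (hB : IsClosed B) (x₀ : X) (hx₀ : x₀ ∈ A ∩ B)
    (htt : TangentiallyTransversal A B x₀)
    (htr : ConesTransversal (clarkeTangentCone A x₀) (clarkeTangentCone B x₀)) :
    clarkeNormalCone (A ∩ B) x₀ ⊆ clarkeNormalCone A x₀ + clarkeNormalCone B x₀ ∧
      IsClosed (StrongDual.toWeakDual '' (clarkeNormalCone A x₀ + clarkeNormalCone B x₀) :
        Set (WeakDual ℝ X)) := by
  rw [clarkeNormalCone_add_eq htr]
  exact ⟨fun f hf v hv => hf v (inter_clarkeTangentCone_subset hA hB htt hv),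
    isClosed_toWeakDual_image_polar _⟩
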